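/- Let $a,b\in\mathbb R$ with $b-a>1$, and let $\mu$ be a probability measure on $\mathbb R$ with $\mathrm{Supp}(\mu)\subset[a,b]$ and $\{a,b\}\subset\mathrm{Supp}(\mu)$. Suppose that there are integers $x^{(n)}_1>x^{(n)}_2>\cdots>x^{(n)}_n$ for each $n\ge1$ such that $\frac1n\sum_{i=1}^n\delta_{x_i^{(n)}/n}\to\mu$ weakly as $n\to\infty$. Then $\mu\le\lambda$, where $\lambda$ is Lebesgue measure; let $\varphi:\mathbb R\to[0,1]$ be (any measurable version of) the density of $\mu$, for instance one that vanishes outside $[a,b]$. For $(\chi,\eta)\in\mathbb R^2$ and $w\in\mathbb C\setminus\mathbb R$ put $$f'_{(\chi,\eta)}(w):=\int_{\mathbb R}\frac{\mu[dx]}{w-x}-\int_{\chi+\eta-1}^{\chi}\frac{dx}{w-x}.$$ The liquid region $\mathcal L\subset\mathbb R^2$ is the set of all $(\chi,\eta)\in[a,b]\times[0,1]$ with $b\ge\chi\ge\chi+\eta-1\ge a$ for which $f'_{(\chi,\eta)}$ has a root in $\mathbb C\setminus\mathbb R$; $\partial\mathcal L$ is its topological boundary in $\mathbb R^2$. Let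 $\mathbb H:=\{w\in\mathbb C:\mathrm{Im}(w)>0\}$. The map which sends $(\chi,\eta)\in\mathcal L$ to the unique root of $f'_{(\chi,\eta)}$ in $\mathbb H$ is a bijection $\mathcal L\to\mathbb H$; denote its inverse by $w\mapsto(\chi_{\mathcal L}(w),\eta_{\mathcal L}(w))$, that is, $(\chi_{\mathcal L}(w),\eta_{\mathcal L}(w))$ is the point $(\chi,\eta)$ of $\mathcal L$ with $f'_{(\chi,\eta)}(w)=0$. Let $$R:=\Big(\,\overline{(\mathbb R\setminus\mathrm{Supp}(\mu))\cup(\mathbb R\setminus\mathrm{Supp}(\lambda-\mu))}\,\Big)^{\circ}.$$ Let $t\in\mathbb R\setminus R$ and suppose that for some $\epsilon>0$ one of the following holds: 1. $\sup_{(t-\epsilon,t+\epsilon)}\varphi<1$ and $\inf_{(t-\epsilon,t+\epsilon)}\varphi>0$; 2. $\sup_{(t-\epsilon,t)}\varphi<1$, $\inf_{(t-\epsilon,t)}\varphi>0$, and $\varphi(x)=0$ for all $x\in(t,t+\epsilon)$; 3. $\sup_{(t-\epsilon,t)}\varphi<1$, $\inf_{(t-\epsilon,t)}\varphi>0$, and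 $\varphi(x)=1$ for all $x\in(t,t+\epsilon)$; 4. $\sup_{(t,t+\epsilon)}\varphi<1$, $\inf_{(t,t+\epsilon)}\varphi>0$, and $\varphi(x)=0$ for all $x\in(t-\epsilon,t)$; 5. $\sup_{(t,t+\epsilon)}\varphi<1$, $\inf_{(t,t+\epsilon)}\varphi>0$, and $\varphi(x)=1$ for all $x\in(t-\epsilon,t)$. Then $(t,1)\in\partial\mathcal L$. Moreover $(\chi_{\mathcal L}(w_n),\eta_{\mathcal L}(w_n))\to(t,1)$ as $n\to\infty$ for every sequence $(w_n)_{n\ge1}$ in $\mathbb H$ with $w_n\to t$. -/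

import Mathlib

open MeasureTheory Filter Topology

noncomputable section

namespace GTLiquid

/-- The empirical measure `(1/n) ∑ δ_{x_i / n}` of the rescaled particles `x_1 / n, …, x_n / n`. -/
def empiricalMeasure (n : ℕ) (x : Fin n → ℤ) : FiniteMeasure ℝ :=
  ⟨(n : NNReal)⁻¹ • ∑ i : Fin n, Measure.dirac ((x i : ℝ) / (n : ℝ)), inferInstance⟩

/-- The Cauchy transform `C(w) = ∫ μ[dx] / (w - x)`, used for non-real `w` only. -/
def cauchyTransform (μ : Measure ℝ) (w : ℂ) : ℂ :=
  ∫ x : ℝ, 1 / (w - (x : ℂ)) ∂μ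

/-- The function
`f'_{(χ,η)}(w) = ∫ μ[dx] / (w - x) - ∫_{χ+η-1}^{χ} dx / (w - x)`, with `p = (χ, η)`,
used for non-real `w` only. -/
def fPrime (μ : Measure ℝ) (p : ℝ × ℝ) (w : ℂ) : ℂ :=
  cauchyTransform μ w - ∫ x in (p.1 + p.2 - 1)..p.1, 1 / (w - (x : ℂ))

/-- The asymptotic shape: all `(χ, η) ∈ [a,b] × [0,1]` with `b ≥ χ ≥ χ + η - 1 ≥ a`. -/
def shape (a b : ℝ) : Set (ℝ × ℝ) :=
  {p | p.1 ∈ Set.Icc a b ∧ p.2 ∈ Set.Icc (0 : ℝ) 1 ∧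
    p.1 ≤ b ∧ p.1 + p.2 - 1 ≤ p.1 ∧ a ≤ p.1 + p.2 - 1}

/-- The liquid region: all points of the shape for which `f'` has a non-real root. -/
def liquidRegion (μ : Measure ℝ) (a b : ℝ) : Set (ℝ × ℝ) :=
  {p | p ∈ shape a b ∧ ∃ w : ℂ, w.im ≠ 0 ∧ fPrime μ p w = 0}

/-- The map `w ↦ (χ_L(w), η_L(w))` from the upper half-plane to the liquid region, inverse to the
map which sends a point of the liquid region to the root of `f'` in the upper half-plane: the
point `(χ, η)` of the liquid region for which `w` is a root of `f'_{(χ,η)}`. -/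
def liquidInverse (μ : Measure ℝ) (a b : ℝ) (w : UpperHalfPlane) : ℝ × ℝ :=
  Classical.epsilon fun p : ℝ × ℝ => p ∈ liquidRegion μ a b ∧ fPrime μ p (w : ℂ) = 0

/-- The open set `R`, the interior of the closure of
`(ℝ \ Supp μ) ∪ (ℝ \ Supp (λ - μ))`, where `λ` is Lebesgue measure. -/
def edgeParameters (μ : Measure ℝ) : Set ℝ :=
  interior (closure (μ.supportᶜ ∪ ((volume : Measure ℝ) - μ).supportᶜ))

/-- `φ` is bounded away from both `0` and `1` on `s`: `sup_s φ < 1` and `inf_s φ > 0`. (Used for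
non-empty `s` and `φ` with values in `[0,1]`.) -/
def StrictlyBetween (φ : ℝ → ℝ) (s : Set ℝ) : Prop :=
  sSup (φ '' s) < 1 ∧ 0 < sInf (φ '' s)

/-- The five admissible behaviours of the density `φ` in the `ε`-neighbourhood of `t`. -/
def LocalCase (φ : ℝ → ℝ) (t ε : ℝ) : Prop :=
  StrictlyBetween φ (Set.Ioo (t - ε) (t + ε)) ∨
  (StrictlyBetween φ (Set.Ioo (t - ε) t) ∧ ∀ x ∈ Set.Ioo t (t + ε), φ x = 0) ∨
  (StrictlyBetween φ (Set.Ioo (t - ε) t) ∧ ∀ x ∈ Set.Ioo t (t + ε), φ x = 1) ∨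
  (StrictlyBetween φ (Set.Ioo t (t + ε)) ∧ ∀ x ∈ Set.Ioo (t - ε) t, φ x = 0) ∨
  (StrictlyBetween φ (Set.Ioo t (t + ε)) ∧ ∀ x ∈ Set.Ioo (t - ε) t, φ x = 1)

end GTLiquid

end

/-! Write `d = χ + η - 1`, `c = χ` and `g = φ - 1_{(d,c]}`. A root `w` of `f'` makes `g` orthogonal
to `1/(w - x)`; real and imaginary parts then give `∫ g(x)(αx + β)/|w - x|² dx = 0` for all real `α,
β` (`integral_affine_div_normSq`). Everything follows from choosing affine functions with the sign
of `g`.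

Existence: the Cauchy transform has imaginary part in `(-π, 0)`, so it equals `∫_d^c dx/(w - x)` for
some `d < c`. Affine tests then force `(c, d - c + 1)` into the shape (`exists_mem_liquidRegion`).

Convergence: let roots tend to `t` and the endpoints to `d₀, c₀`. Unless `d₀ = c₀ = t`, `g` changes
sign at most once near `t`, and some affine function matches its sign there. On one side of `t`,
`|g| ≥ δ`, so Fatou would make `1/|x - t|` integrable there (`false_of_blowup`,
`tendsto_endpoints_eq`). Compactness of the shape concludes. -/

namespace GTLiquid

/-! ### Roots of `f'` as an orthogonality relation -/

/-- The difference of a density `φ` and the density of Lebesgue measure on `(d, c]`. -/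
noncomputable def excess (φ : ℝ → ℝ) (d c x : ℝ) : ℝ :=
  φ x - (Set.Ioc d c).indicator (fun _ => (1 : ℝ)) x

lemma sub_ofReal_ne_zero {w : ℂ} (hw : 0 < w.im) (x : ℝ) : w - (x : ℂ) ≠ 0 := by
  intro h
  have := congrArg Complex.im h
  simp at this
  linarith

lemma normSq_sub_ofReal (w : ℂ) (x : ℝ) :
    Complex.normSq (w - x) = (w.re - x) ^ 2 + w.im ^ 2 := by
  rw [Complex.normSq_apply]; simp; ring

lemma normSq_sub_ofReal_pos {w : ℂ} (hw : 0 < w.im) (x : ℝ) : 0 < Complex.normSq (w - x) :=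
  Complex.normSq_pos.2 (sub_ofReal_ne_zero hw x)

lemma continuous_one_div_sub_ofReal {w : ℂ} (hw : 0 < w.im) :
    Continuous fun x : ℝ => 1 / (w - (x : ℂ)) :=
  continuous_const.div (by fun_prop) (sub_ofReal_ne_zero hw)

lemma norm_one_div_sub_ofReal_le {w : ℂ} (hw : 0 < w.im) (x : ℝ) :
    ‖1 / (w - (x : ℂ))‖ ≤ 1 / w.im := by
  rw [norm_div, norm_one]
  refine one_div_le_one_div_of_le hw ?_
  have := Complex.abs_im_le_norm (w - (x : ℂ))
  simp at this
  exact (le_abs_self _).trans this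

lemma integrable_ofReal_mul_one_div {w : ℂ} (hw : 0 < w.im) {g : ℝ → ℝ} (hg : Integrable g) :
    Integrable fun x : ℝ => (g x : ℂ) * (1 / (w - (x : ℂ))) := by
  have h := Integrable.bdd_mul (hg.ofReal (𝕜 := ℂ))
    (continuous_one_div_sub_ofReal hw).aestronglyMeasurable
    (Eventually.of_forall (norm_one_div_sub_ofReal_le hw))
  refine h.congr (Eventually.of_forall fun x => ?_)
  simp [mul_comm]

lemma integrable_indicator_Ioc (d c : ℝ) :
    Integrable ((Set.Ioc d c).indicator fun _ => (1 : ℝ)) :=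
  (integrable_indicator_iff measurableSet_Ioc).2 (by simp)

lemma integrable_excess {φ : ℝ → ℝ} (hφ : Integrable φ) (d c : ℝ) :
    Integrable (excess φ d c) :=
  hφ.sub (integrable_indicator_Ioc d c)

lemma integral_excess {φ : ℝ → ℝ} (hφ : Integrable φ) {d c : ℝ} (hdc : d ≤ c) :
    ∫ x, excess φ d c x = (∫ x, φ x) - (c - d) := by
  unfold excess
  rw [integral_sub hφ (integrable_indicator_Ioc d c), integral_indicator measurableSet_Ioc]
  simp [hdc]

lemma cauchyTransform_withDensity {φ : ℝ → ℝ} (hm : Measurable φ) (h0 : ∀ x, 0 ≤ φ x) (w : ℂ) :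
    cauchyTransform (volume.withDensity fun y => ENNReal.ofReal (φ y)) w =
      ∫ x, (φ x : ℂ) * (1 / (w - (x : ℂ))) := by
  unfold cauchyTransform
  rw [integral_withDensity_eq_integral_toReal_smul (by fun_prop) (by simp)]
  simp [h0]

lemma fPrime_withDensity {φ : ℝ → ℝ} (hm : Measurable φ) (h0 : ∀ x, 0 ≤ φ x) (hφ : Integrable φ)
    {p : ℝ × ℝ} (hp : p.2 ≤ 1) {w : ℂ} (hw : 0 < w.im) :
    fPrime (volume.withDensity fun y => ENNReal.ofReal (φ y)) p w =
      ∫ x, (excess φ (p.1 + p.2 - 1) p.1 x : ℂ) * (1 / (w - (x : ℂ))) := by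
  unfold fPrime
  rw [cauchyTransform_withDensity hm h0, intervalIntegral.integral_of_le (by linarith),
    ← integral_indicator measurableSet_Ioc, ← integral_sub (integrable_ofReal_mul_one_div hw hφ)]
  · refine integral_congr_ae (Eventually.of_forall fun x => ?_)
    by_cases hx : x ∈ Set.Ioc (p.1 + p.2 - 1) p.1
    · simp [excess, hx]; ring
    · simp [excess, hx]
  · refine (integrable_ofReal_mul_one_div hw
      (integrable_indicator_Ioc (p.1 + p.2 - 1) p.1)).congr
      (Eventually.of_forall fun x => ?_)
    by_cases hx : x ∈ Set.Ioc (p.1 + p.2 - 1) p.1 <;> simp [hx]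

/-- A function is orthogonal to the kernel `1 / (w - x)` iff it is orthogonal to all
affine functions over `|w - x|²`. -/
lemma integral_affine_div_normSq {w : ℂ} (hw : 0 < w.im) {g : ℝ → ℝ} (hg : Integrable g)
    (h : ∫ x, (g x : ℂ) * (1 / (w - (x : ℂ))) = 0) (α β : ℝ) :
    Integrable (fun x : ℝ => g x * (α * x + β) / Complex.normSq (w - x)) ∧
      ∫ x : ℝ, g x * (α * x + β) / Complex.normSq (w - x) = 0 := by
  -- The real and imaginary parts of `1/(w - x)` are `(Re w - x)/|w - x|²` and `-Im w/|w - x|²`;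
  -- expand `αx + β = -α(Re w - x) + (α Re w + β)`.
  let L : ℂ →L[ℝ] ℝ := (-α) • Complex.reCLM + (-(α * w.re + β) / w.im) • Complex.imCLM
  have key : (fun x : ℝ => g x * (α * x + β) / Complex.normSq (w - x)) =
      fun x : ℝ => L ((g x : ℂ) * (1 / (w - (x : ℂ)))) := by
    funext x
    have := normSq_sub_ofReal_pos hw x
    simp only [L, one_div]
    simp [Complex.inv_re, Complex.inv_im]
    field_simp
    ring
  have hi := integrable_ofReal_mul_one_div hw hg
  rw [key]
  exact ⟨L.integrable_comp hi, by rw [L.integral_comp_comm hi, h, map_zero]⟩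

/-! ### Values of the Cauchy transform and of interval integrals -/

lemma integral_one_div_sub {w : ℂ} (hw : 0 < w.im) (d c : ℝ) :
    ∫ x in d..c, 1 / (w - (x : ℂ)) = Complex.log (w - d) - Complex.log (w - c) := by
  rw [intervalIntegral.integral_eq_sub_of_hasDerivAt (f := fun x : ℝ => -Complex.log (w - x))]
  · ring
  · intro x _
    have h1 : HasDerivAt (fun x : ℝ => w - (x : ℂ)) (-1) x := by
      simpa using (Complex.ofRealCLM.hasDerivAt (x := x)).const_sub w
    have h2 := (h1.clog_real (Or.inr (by simpa using hw.ne'))).neg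
    convert h2 using 1
    · rfl
    · ring
  · exact (continuous_one_div_sub_ofReal hw).intervalIntegrable _ _

lemma im_ofReal_mul_one_div {w : ℂ} (g : ℝ) (x : ℝ) :
    ((g : ℂ) * (1 / (w - (x : ℂ)))).im = -(g * w.im / Complex.normSq (w - x)) := by
  simp [Complex.inv_im]; ring

lemma im_cauchy_neg {w : ℂ} (hw : 0 < w.im) {φ : ℝ → ℝ} (h0 : ∀ x, 0 ≤ φ x)
    (hφ : Integrable φ) (h1 : 0 < ∫ x, φ x) :
    (∫ x, (φ x : ℂ) * (1 / (w - (x : ℂ)))).im < 0 := by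
  have hi := integrable_ofReal_mul_one_div hw hφ
  rw [show (∫ x, (φ x : ℂ) * (1 / (w - (x : ℂ)))).im =
    ∫ x, ((φ x : ℂ) * (1 / (w - (x : ℂ)))).im from
      (Complex.imCLM.integral_comp_comm hi).symm]
  have hi' : Integrable fun x => ((φ x : ℂ) * (1 / (w - (x : ℂ)))).im :=
    Complex.imCLM.integrable_comp hi
  simp only [im_ofReal_mul_one_div] at hi' ⊢
  rw [integral_neg, neg_lt_zero]
  rw [integral_pos_iff_support_of_nonneg _ (by simpa using hi'.neg)]
  · rw [integral_pos_iff_support_of_nonneg h0 hφ] at h1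
    convert h1 using 2
    ext x
    have := normSq_sub_ofReal_pos hw x
    simp [hw.ne', this.ne']
  · intro x
    have := normSq_sub_ofReal_pos hw x
    have := h0 x
    simp only [Pi.zero_apply]
    positivity

/-- The kernel has negative imaginary part and `φ ≤ 1_{(a,b]}` a.e., so the full interval is
extremal; it gives `arg(w - a) - arg(w - b) > -π`. -/
lemma neg_pi_lt_im_cauchy {w : ℂ} (hw : 0 < w.im) {φ : ℝ → ℝ} {a b : ℝ} (hab : a ≤ b)
    (h1 : ∀ x, φ x ≤ 1) (hφ : Integrable φ) (hout : ∀ᵐ x, x ∉ Set.Ioc a b → φ x = 0) :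
    -Real.pi < (∫ x, (φ x : ℂ) * (1 / (w - (x : ℂ)))).im := by
  have hlog : -Real.pi < (∫ x in a..b, 1 / (w - (x : ℂ))).im := by
    rw [integral_one_div_sub hw, Complex.sub_im, Complex.log_im, Complex.log_im]
    have ha : 0 ≤ Complex.arg (w - a) := Complex.arg_nonneg_iff.2 (by simpa using hw.le)
    have hb : Complex.arg (w - b) < Real.pi :=
      lt_of_le_of_ne (Complex.arg_le_pi _) fun h => by
        have := (Complex.arg_eq_pi_iff.1 h).2
        simp at this
        linarith
    linarith
  refine hlog.trans_le ?_
  rw [intervalIntegral.integral_of_le hab, ← integral_indicator measurableSet_Ioc]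
  have hind : (Set.Ioc a b).indicator (fun x : ℝ => 1 / (w - (x : ℂ))) =
      fun x : ℝ => (((Set.Ioc a b).indicator (fun _ => (1 : ℝ)) x : ℝ) : ℂ) *
        (1 / (w - (x : ℂ))) := by
    funext x
    by_cases hx : x ∈ Set.Ioc a b <;> simp [hx]
  have hi := integrable_ofReal_mul_one_div hw hφ
  have hj := integrable_ofReal_mul_one_div hw (integrable_indicator_Ioc a b)
  rw [hind]
  change Complex.imCLM _ ≤ Complex.imCLM _
  rw [← Complex.imCLM.integral_comp_comm hi, ← Complex.imCLM.integral_comp_comm hj]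
  refine integral_mono_ae (Complex.imCLM.integrable_comp hj) (Complex.imCLM.integrable_comp hi) ?_
  filter_upwards [hout] with x hx
  simp only [Complex.imCLM_apply, im_ofReal_mul_one_div]
  have hN := normSq_sub_ofReal_pos hw x
  have : φ x ≤ (Set.Ioc a b).indicator (fun _ => (1 : ℝ)) x := by
    by_cases h : x ∈ Set.Ioc a b
    · simpa [h] using h1 x
    · simp [h, hx h]
  rw [neg_le_neg_iff]
  gcongr

/-- Every value in the strip `-π < Im z < 0` is `∫_d^c dx / (w - x)` for some `d < c`. -/
lemma exists_integral_one_div_eq {w z : ℂ} (hw : 0 < w.im) (h1 : -Real.pi < z.im)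
    (h2 : z.im < 0) : ∃ d c : ℝ, d < c ∧ ∫ x in d..c, 1 / (w - (x : ℂ)) = z := by
  set E := Complex.exp z with hE
  have hEim : E.im < 0 := by
    rw [hE, Complex.exp_im]
    exact mul_neg_of_pos_of_neg (Real.exp_pos _) (Real.sin_neg_of_neg_of_neg_pi_lt h2 h1)
  -- The real unknowns must solve `w - d = E(w - c)`: the imaginary part determines `c`, the real
  -- part then `d`.
  set c : ℝ := ((E * w).im - w.im) / E.im with hc
  set d : ℝ := (w - E * (w - c)).re with hd
  have hEq : w - d = E * (w - c) := by
    apply Complex.ext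
    · simp [hd]
    · have : c * E.im = (E * w).im - w.im := by
        rw [hc, div_mul_cancel₀ _ hEim.ne]
      simp at this ⊢
      linarith
  have hNc := sub_ofReal_ne_zero hw c
  -- Since `E - 1 = (c - d)/(w - c)`, the sign of `Im E` is opposite to that of `c - d`.
  have hdc : d < c := by
    have h : E = ((c - d : ℝ) : ℂ) * (1 / (w - c)) + 1 := by
      push_cast
      field_simp
      linear_combination -hEq
    have him := congrArg Complex.im h
    rw [Complex.add_im, im_ofReal_mul_one_div, Complex.one_im, add_zero] at him
    have hN := normSq_sub_ofReal_pos hw c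
    rw [him, neg_lt_zero] at hEim
    by_contra hcon
    have : (c - d) * w.im / Complex.normSq (w - c) ≤ 0 :=
      div_nonpos_of_nonpos_of_nonneg
        (mul_nonpos_of_nonpos_of_nonneg (by linarith) hw.le) hN.le
    linarith
  refine ⟨d, c, hdc, ?_⟩
  rw [integral_one_div_sub hw]
  have hexp : Complex.exp (Complex.log (w - d) - Complex.log (w - c)) = Complex.exp z := by
    rw [Complex.exp_sub, Complex.exp_log (sub_ofReal_ne_zero hw d), Complex.exp_log hNc, hEq]
    field_simp
    exact hE
  obtain ⟨n, hn⟩ := Complex.exp_eq_exp_iff_exists_int.1 hexp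
  have him := congrArg Complex.im hn
  have arg_mem : ∀ r : ℝ, 0 ≤ (w - (r : ℂ)).arg ∧ (w - (r : ℂ)).arg ≤ Real.pi := fun r =>
    ⟨Complex.arg_nonneg_iff.2 (by simpa using hw.le), Complex.arg_le_pi _⟩
  have hac := arg_mem c
  have had := arg_mem d
  simp only [Complex.sub_im, Complex.log_im, Complex.add_im, Complex.mul_im] at him
  simp at him
  have hpi := Real.pi_pos
  -- Both arguments lie in `[0, π]` and `Im z` in `(-π, 0)`, so `|2πn| < 2π`.
  have hn0 : n = 0 := by
    have hlt : (n : ℝ) < 1 := by nlinarith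
    have hgt : (-1 : ℝ) < n := by nlinarith
    have : n < 1 := by exact_mod_cast hlt
    have : -1 < n := by exact_mod_cast hgt
    omega
  simpa [hn0] using hn

/-! ### Affine tests place the interval in the shape -/

lemma excess_of_mem {φ : ℝ → ℝ} {d c x : ℝ} (hd : d < x) (hc : x ≤ c) :
    excess φ d c x = φ x - 1 := by
  simp [excess, Set.indicator_of_mem (show x ∈ Set.Ioc d c from ⟨hd, hc⟩)]

lemma excess_of_le {φ : ℝ → ℝ} {d c x : ℝ} (hx : x ≤ d) : excess φ d c x = φ x := by
  rw [excess, Set.indicator_of_notMem (fun h => hx.not_gt h.1), sub_zero]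

lemma excess_of_gt {φ : ℝ → ℝ} {d c x : ℝ} (hx : c < x) : excess φ d c x = φ x := by
  rw [excess, Set.indicator_of_notMem (fun h => hx.not_ge h.2), sub_zero]

lemma false_of_integral_eq_zero {h : ℝ → ℝ} (hi : Integrable h) (h0 : 0 ≤ᵐ[volume] h)
    (hint : ∫ x, h x = 0) {p q : ℝ} (hpq : p < q)
    (hpos : ∀ᵐ x, x ∈ Set.Ioo p q → 0 < h x) : False := by
  have hz := (integral_eq_zero_iff_of_nonneg_ae h0 hi).1 hint
  have hnull : ∀ᵐ x, x ∉ Set.Ioo p q := by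
    filter_upwards [hz, hpos] with x h1 h2 h3
    exact (h2 h3).ne' h1
  have : volume (Set.Ioo p q) = 0 := by
    rw [ae_iff] at hnull
    simp only [not_not] at hnull
    exact hnull
  rw [Real.volume_Ioo, ENNReal.ofReal_eq_zero] at this
  linarith

section

variable {φ : ℝ → ℝ} {a b : ℝ}

/-- Test against `x - c`. If `d < a`, the product with the excess is nonnegative a.e., and positive
a.e. on `(d, min a c)`, where the excess is `-1`. -/
lemma le_left_of_orthogonal (h01 : ∀ x, φ x ∈ Set.Icc (0 : ℝ) 1)
    (hφ : Integrable φ) (hout : ∀ᵐ x, x ∉ Set.Icc a b → φ x = 0) {w : ℂ} (hw : 0 < w.im)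
    {d c : ℝ} (hdc : d < c)
    (h : ∫ x, (excess φ d c x : ℂ) * (1 / (w - (x : ℂ))) = 0) : a ≤ d := by
  by_contra! hda
  obtain ⟨hi, hint⟩ := integral_affine_div_normSq hw (integrable_excess hφ d c) h 1 (-c)
  refine false_of_integral_eq_zero hi ?_ hint (lt_min hda hdc) ?_
  · filter_upwards [hout] with x hx
    have hN := normSq_sub_ofReal_pos hw x
    have := h01 x
    refine div_nonneg ?_ hN.le
    rcases le_or_gt x d with h1 | h1
    · rw [excess_of_le h1, hx (fun h2 => by linarith [h2.1])]; simp
    rcases le_or_gt x c with h2 | h2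
    · rw [excess_of_mem h1 h2]; nlinarith [this.2]
    · rw [excess_of_gt h2]; nlinarith [this.1]
  · filter_upwards [hout] with x hx hx2
    have hN := normSq_sub_ofReal_pos hw x
    have h2 := lt_min_iff.1 hx2.2
    refine div_pos ?_ hN
    rw [excess_of_mem hx2.1 h2.2.le, hx (fun h3 => by linarith [h3.1, h2.1])]
    linarith [h2.2]

/-- Mirror image, with test function `d - x`. -/
lemma right_le_of_orthogonal (h01 : ∀ x, φ x ∈ Set.Icc (0 : ℝ) 1)
    (hφ : Integrable φ) (hout : ∀ᵐ x, x ∉ Set.Icc a b → φ x = 0) {w : ℂ} (hw : 0 < w.im)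
    {d c : ℝ} (hdc : d < c)
    (h : ∫ x, (excess φ d c x : ℂ) * (1 / (w - (x : ℂ))) = 0) : c ≤ b := by
  by_contra! hbc
  obtain ⟨hi, hint⟩ := integral_affine_div_normSq hw (integrable_excess hφ d c) h (-1) d
  refine false_of_integral_eq_zero hi ?_ hint (max_lt hbc hdc) ?_
  · filter_upwards [hout] with x hx
    have hN := normSq_sub_ofReal_pos hw x
    have := h01 x
    refine div_nonneg ?_ hN.le
    rcases le_or_gt x d with h1 | h1
    · rw [excess_of_le h1]; nlinarith [this.1]
    rcases le_or_gt x c with h2 | h2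
    · rw [excess_of_mem h1 h2]; nlinarith [this.2]
    · rw [excess_of_gt h2, hx (fun h2 => by linarith [h2.2])]; simp
  · filter_upwards [hout] with x hx hx2
    have hN := normSq_sub_ofReal_pos hw x
    have h2 := max_lt_iff.1 hx2.1
    refine div_pos ?_ hN
    rw [excess_of_mem h2.2 hx2.2.le, hx (fun h3 => by linarith [h3.2, h2.1])]
    linarith [h2.2]

/-- `(x - d)(x - c)` has the sign of the excess and differs from `|w - x|²` by an affine function.
Dividing by `|w - x|²` and integrating, the affine part drops out, leaving `∫ g ≥ 0`. -/
lemma length_le_of_orthogonal (h01 : ∀ x, φ x ∈ Set.Icc (0 : ℝ) 1)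
    (hφ : Integrable φ) {w : ℂ} (hw : 0 < w.im) {d c : ℝ} (hdc : d < c)
    (h : ∫ x, (excess φ d c x : ℂ) * (1 / (w - (x : ℂ))) = 0) : c - d ≤ ∫ x, φ x := by
  have hψ := integrable_excess hφ d c
  obtain ⟨hi, hint⟩ := integral_affine_div_normSq hw hψ h (c + d - 2 * w.re)
    (w.re ^ 2 + w.im ^ 2 - c * d)
  have key : 0 ≤ ∫ x, (excess φ d c x - excess φ d c x * ((c + d - 2 * w.re) * x +
      (w.re ^ 2 + w.im ^ 2 - c * d)) / Complex.normSq (w - x)) := by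
    refine integral_nonneg fun x => ?_
    have hN := normSq_sub_ofReal_pos hw x
    have := h01 x
    have e : excess φ d c x - excess φ d c x * ((c + d - 2 * w.re) * x +
        (w.re ^ 2 + w.im ^ 2 - c * d)) / Complex.normSq (w - x) =
        excess φ d c x * ((x - d) * (x - c)) / Complex.normSq (w - x) := by
      rw [eq_div_iff hN.ne', sub_mul, div_mul_cancel₀ _ hN.ne', normSq_sub_ofReal]
      ring
    simp only [Pi.zero_apply]
    rw [e]
    refine div_nonneg ?_ hN.le
    rcases le_or_gt x d with h1 | h1
    · rw [excess_of_le h1]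
      exact mul_nonneg this.1 (mul_nonneg_of_nonpos_of_nonpos (by linarith) (by linarith))
    rcases le_or_gt x c with h2 | h2
    · rw [excess_of_mem h1 h2]
      exact mul_nonneg_of_nonpos_of_nonpos (by linarith [this.2])
        (mul_nonpos_of_nonneg_of_nonpos (by linarith) (by linarith))
    · rw [excess_of_gt h2]
      exact mul_nonneg this.1 (mul_nonneg (by linarith) (by linarith))
  rw [integral_sub hψ hi, hint, integral_excess hφ hdc.le] at key
  linarith

/-- Every point of the upper half-plane is a root for some point of the liquid region. -/
theorem exists_mem_liquidRegion (hab : a ≤ b) (hm : Measurable φ)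
    (h01 : ∀ x, φ x ∈ Set.Icc (0 : ℝ) 1)
    (hφ : Integrable φ) (h1 : ∫ x, φ x = 1) (hout : ∀ᵐ x, x ∉ Set.Icc a b → φ x = 0)
    {w : ℂ} (hw : 0 < w.im) :
    ∃ p, p ∈ liquidRegion (volume.withDensity fun y => ENNReal.ofReal (φ y)) a b ∧
      fPrime (volume.withDensity fun y => ENNReal.ofReal (φ y)) p w = 0 := by
  have h0 : ∀ x, 0 ≤ φ x := fun x => (h01 x).1
  have hout' : ∀ᵐ x, x ∉ Set.Ioc a b → φ x = 0 := by
    filter_upwards [hout, Measure.ae_ne volume a] with x hx hxa hx2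
    exact hx fun h3 => hx2 ⟨lt_of_le_of_ne h3.1 hxa.symm, h3.2⟩
  obtain ⟨d, c, hdc, heq⟩ := exists_integral_one_div_eq hw
    (neg_pi_lt_im_cauchy hw hab (fun x => (h01 x).2) hφ hout')
    (im_cauchy_neg hw h0 hφ (by rw [h1]; exact one_pos))
  have hd : c + (d - c + 1) - 1 = d := by ring
  have hroot : fPrime (volume.withDensity fun y => ENNReal.ofReal (φ y)) (c, d - c + 1) w = 0 := by
    rw [fPrime, cauchyTransform_withDensity hm h0]
    simp only [hd]
    rw [heq, sub_self]
  have horth := hroot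
  rw [fPrime_withDensity hm h0 hφ (by simpa using hdc.le) hw] at horth
  simp only [hd] at horth
  have ha := le_left_of_orthogonal h01 hφ hout hw hdc horth
  have hb := right_le_of_orthogonal h01 hφ hout hw hdc horth
  have hl := length_le_of_orthogonal h01 hφ hw hdc horth
  rw [h1] at hl
  refine ⟨(c, d - c + 1), ⟨⟨⟨?_, hb⟩, ⟨?_, ?_⟩, hb, ?_, ?_⟩, w, hw.ne', hroot⟩, hroot⟩ <;>
    dsimp only <;> linarith

end

/-! ### Blow-up at `t` and collapse of the intervals -/

/-- `J` is a one-sided punctured neighbourhood of `t` of length `ε`. -/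
def IsSide (J : Set ℝ) (t ε : ℝ) : Prop :=
  J = Set.Ioo (t - ε) t ∨ J = Set.Ioo t (t + ε)

lemma IsSide.measurableSet {J : Set ℝ} {t ε : ℝ} (hJ : IsSide J t ε) : MeasurableSet J := by
  rcases hJ with rfl | rfl <;> exact measurableSet_Ioo

lemma IsSide.mem_Ioo {J : Set ℝ} {t ε : ℝ} (hJ : IsSide J t ε) {x : ℝ} (hx : x ∈ J) :
    x ∈ Set.Ioo (t - ε) (t + ε) := by
  rcases hJ with rfl | rfl <;> constructor <;> linarith [hx.1, hx.2]

lemma IsSide.ne {J : Set ℝ} {t ε : ℝ} (hJ : IsSide J t ε) {x : ℝ} (hx : x ∈ J) : x ≠ t := by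
  rcases hJ with rfl | rfl
  · exact hx.2.ne
  · exact hx.1.ne'

lemma IsSide.shrink {J : Set ℝ} {t ε ρ : ℝ} (hJ : IsSide J t ε) (h : ρ ≤ ε) :
    ∃ J', IsSide J' t ρ ∧ J' ⊆ J := by
  rcases hJ with rfl | rfl
  · exact ⟨_, Or.inl rfl, Set.Ioo_subset_Ioo (by linarith) le_rfl⟩
  · exact ⟨_, Or.inr rfl, Set.Ioo_subset_Ioo le_rfl (by linarith)⟩

lemma IsSide.not_integrableOn {J : Set ℝ} {t ε : ℝ} (hε : 0 < ε) (hJ : IsSide J t ε) :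
    ¬ IntegrableOn (fun x => (x - t)⁻¹) J := by
  intro h
  rcases hJ with rfl | rfl
  · rw [← intervalIntegrable_iff_integrableOn_Ioo_of_le (by linarith),
      intervalIntegrable_sub_inv_iff] at h
    rcases h with h | h
    · linarith
    · exact h Set.right_mem_uIcc
  · rw [← intervalIntegrable_iff_integrableOn_Ioo_of_le (by linarith),
      intervalIntegrable_sub_inv_iff] at h
    rcases h with h | h
    · linarith
    · exact h Set.left_mem_uIcc

/-- Fatou for `h n` plus the bound `K` on `[a, b]`: these integrals eventually equal `K(b - a)`,
while the lower limit dominates the non-integrable `κ/|x - t|` on `J`. -/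
lemma false_of_blowup {J : Set ℝ} {t ε : ℝ} (hε : 0 < ε) (hJ : IsSide J t ε)
    {a b K κ : ℝ} (hab : a ≤ b) (hκ : 0 < κ)
    {h q : ℕ → ℝ → ℝ} {l : ℝ → ℝ} (hi : ∀ n, Integrable (h n)) (hint : ∀ n, ∫ x, h n x = 0)
    (hK : ∀ᶠ n in atTop, ∀ᵐ x, -(Set.Icc a b).indicator (fun _ => K) x ≤ h n x)
    (hK0 : 0 ≤ K)
    (hq : ∀ᶠ n in atTop, ∀ x ∈ J, q n x ≤ h n x)
    (hlim : ∀ x ∈ J, Tendsto (fun n => q n x) atTop (𝓝 (l x)))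
    (hl : ∀ x ∈ J, κ * |x - t|⁻¹ ≤ l x) : False := by
  set B : ℝ → ℝ := (Set.Icc a b).indicator fun _ => K with hB
  have hB0 : ∀ x, 0 ≤ B x := fun x => Set.indicator_nonneg (fun _ _ => hK0) x
  have hBi : Integrable B := (integrable_indicator_iff measurableSet_Icc).2 (by simp)
  have hBint : ∫ x, B x = K * (b - a) := by
    rw [hB, integral_indicator measurableSet_Icc]
    simp [hab, mul_comm]
  have hfin : ∫⁻ x in J, ENNReal.ofReal (κ * |x - t|⁻¹) ≤ ENNReal.ofReal (K * (b - a)) := by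
    calc ∫⁻ x in J, ENNReal.ofReal (κ * |x - t|⁻¹)
        ≤ ∫⁻ x in J, liminf (fun n => ENNReal.ofReal (h n x + B x)) atTop := by
          refine setLIntegral_mono' hJ.measurableSet fun x hx => ?_
          have h1 : Tendsto (fun n => ENNReal.ofReal (q n x)) atTop (𝓝 (ENNReal.ofReal (l x))) :=
            ENNReal.tendsto_ofReal (hlim x hx)
          calc ENNReal.ofReal (κ * |x - t|⁻¹) ≤ ENNReal.ofReal (l x) :=
                ENNReal.ofReal_le_ofReal (hl x hx)
            _ = liminf (fun n => ENNReal.ofReal (q n x)) atTop := h1.liminf_eq.symm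
            _ ≤ _ := by
                refine liminf_le_liminf ?_
                filter_upwards [hq] with n hn
                exact ENNReal.ofReal_le_ofReal (by linarith [hn x hx, hB0 x])
      _ ≤ ∫⁻ x, liminf (fun n => ENNReal.ofReal (h n x + B x)) atTop :=
          setLIntegral_le_lintegral _ _
      _ ≤ liminf (fun n => ∫⁻ x, ENNReal.ofReal (h n x + B x)) atTop :=
          lintegral_liminf_le' fun n =>
            ((hi n).add hBi).aestronglyMeasurable.aemeasurable.ennreal_ofReal
      _ = liminf (fun _ : ℕ => ENNReal.ofReal (K * (b - a))) atTop := by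
          refine liminf_congr ?_
          filter_upwards [hK] with n hn
          rw [← ofReal_integral_eq_lintegral_ofReal (f := fun x => h n x + B x)
            ((hi n).add hBi), integral_add (hi n) hBi,
            hint n, hBint, zero_add]
          filter_upwards [hn] with x hx
          simp only [Pi.zero_apply]
          linarith
      _ = _ := liminf_const _
  refine hJ.not_integrableOn hε ⟨by fun_prop, ?_⟩
  rw [hasFiniteIntegral_iff_norm]
  have h2 : ∀ x : ℝ, ENNReal.ofReal ‖(x - t)⁻¹‖ =
      ENNReal.ofReal κ⁻¹ * ENNReal.ofReal (κ * |x - t|⁻¹) := by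
    intro x
    rw [← ENNReal.ofReal_mul (by positivity), Real.norm_eq_abs, abs_inv]
    congr 1
    field_simp
  simp_rw [h2]
  rw [lintegral_const_mul' _ _ ENNReal.ofReal_ne_top]
  exact ENNReal.mul_lt_top ENNReal.ofReal_lt_top (hfin.trans_lt ENNReal.ofReal_lt_top)

section

variable {φ : ℝ → ℝ} {a b : ℝ}

lemma abs_excess_le_one (h01 : ∀ x, φ x ∈ Set.Icc (0 : ℝ) 1) (d c x : ℝ) :
    |excess φ d c x| ≤ 1 := by
  have := h01 x
  rw [abs_le]
  by_cases hx : x ∈ Set.Ioc d c <;> simp [excess, hx] <;> constructor <;>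
    linarith [this.1, this.2]

lemma le_abs_excess {δ d c x : ℝ} (h : φ x ∈ Set.Icc δ (1 - δ)) : δ ≤ |excess φ d c x| := by
  rw [le_abs]
  by_cases hx : x ∈ Set.Ioc d c <;> simp [excess, hx]
  · right; linarith [h.2]
  · left; exact h.1

/-- The base point `s n` moves with `n` because the sign change to be matched sits at a moving
endpoint. On the side of `t` the integrand has lower limit at least `δ/|x - t|`. -/
lemma false_of_excess_mul_nonneg (hab : a ≤ b) (h01 : ∀ x, φ x ∈ Set.Icc (0 : ℝ) 1)
    (hφ : Integrable φ) (hout : ∀ᵐ x, x ∉ Set.Icc a b → φ x = 0)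
    {J : Set ℝ} {t ε ρ δ : ℝ} (hJ : IsSide J t ε) (hρ : 0 < ρ) (hρε : ρ ≤ ε) (hδ : 0 < δ)
    (hφJ : ∀ x ∈ J, φ x ∈ Set.Icc δ (1 - δ))
    {w : ℕ → ℂ} (hw : ∀ n, 0 < (w n).im) (hwt : Tendsto w atTop (𝓝 (t : ℂ)))
    {d c : ℕ → ℝ} (had : ∀ n, a ≤ d n) (hcb : ∀ n, c n ≤ b)
    (horth : ∀ n, ∫ x, (excess φ (d n) (c n) x : ℂ) * (1 / (w n - (x : ℂ))) = 0)
    {α β : ℝ} {s : ℕ → ℝ} {s₀ : ℝ} (hs : ∀ n, s n ∈ Set.Icc a b) (hst : Tendsto s atTop (𝓝 s₀))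
    (hl : ∀ x ∈ Set.Ioo (t - ρ) (t + ρ), |x - t| ≤ |α * (x - s₀) + β|)
    (hpos : ∀ᶠ n in atTop, ∀ x ∈ Set.Ioo (t - ρ) (t + ρ),
      0 ≤ excess φ (d n) (c n) x * (α * (x - s n) + β)) : False := by
  obtain ⟨J', hJ', hJJ⟩ := hJ.shrink hρε
  set M : ℝ := |α| * (b - a) + |β| with hM
  have hM0 : 0 ≤ M := by
    have : 0 ≤ b - a := by linarith
    positivity
  have hint := fun n => integral_affine_div_normSq (hw n)
    (integrable_excess hφ (d n) (c n)) (horth n) α (β - α * s n)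
  have hre : ∀ n x, α * x + (β - α * s n) = α * (x - s n) + β := fun n x => by ring
  simp only [hre] at hint
  have hNt : ∀ x : ℝ, Tendsto (fun n => Complex.normSq (w n - x)) atTop (𝓝 ((x - t) ^ 2)) := by
    intro x
    have h1 : Tendsto (fun n => Complex.normSq (w n - x)) atTop
        (𝓝 (Complex.normSq ((t : ℂ) - x))) :=
      (Complex.continuous_normSq.tendsto _).comp (hwt.sub_const _)
    convert h1 using 2
    rw [normSq_sub_ofReal]; simp; ring
  -- `M` bounds the affine function on `[a, b]`, and `|w n - x| ≥ ρ/2` off the `ρ`-neighbourhood of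
  -- `t` for large `n`; hence `K`.
  refine false_of_blowup (h := fun n x => excess φ (d n) (c n) x * (α * (x - s n) + β) /
      Complex.normSq (w n - x)) (q := fun n x => δ * |α * (x - s n) + β| /
      Complex.normSq (w n - x)) (l := fun x => δ * |α * (x - s₀) + β| / (x - t) ^ 2)
    (K := M / (ρ / 2) ^ 2) (κ := δ) hρ hJ' hab hδ (fun n => (hint n).1) (fun n => (hint n).2)
    ?_ (by positivity) ?_ ?_ ?_
  · have hclose : ∀ᶠ n in atTop, |(w n).re - t| < ρ / 2 := by
      have h1 : Tendsto (fun n => (w n).re) atTop (𝓝 t) :=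
        (Complex.continuous_re.tendsto _).comp hwt
      have := Metric.tendsto_nhds.1 h1 (ρ / 2) (by positivity)
      simpa [Real.dist_eq] using this
    filter_upwards [hclose, hpos] with n hn hn2
    filter_upwards [hout] with x hx
    have hN := normSq_sub_ofReal_pos (hw n) x
    by_cases hxρ : x ∈ Set.Ioo (t - ρ) (t + ρ)
    · exact (neg_nonpos.2 (Set.indicator_nonneg (fun _ _ => by positivity) x)).trans
        (div_nonneg (hn2 x hxρ) hN.le)
    by_cases hxab : x ∈ Set.Icc a b
    · rw [Set.indicator_of_mem hxab]
      refine (neg_le_neg ?_).trans (neg_abs_le _)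
      rw [abs_div, abs_mul, abs_of_pos hN]
      refine div_le_div₀ hM0 ?_ (by positivity) ?_
      · have h1 := abs_excess_le_one h01 (d n) (c n) x
        have h2 : |α * (x - s n) + β| ≤ M := by
          refine (abs_add_le _ _).trans ?_
          rw [abs_mul, hM]
          have : |x - s n| ≤ b - a := by
            rw [abs_le]
            constructor <;> linarith [hxab.1, hxab.2, (hs n).1, (hs n).2]
          gcongr
        calc _ ≤ 1 * M := mul_le_mul h1 h2 (abs_nonneg _) zero_le_one
          _ = M := one_mul M
      · rw [normSq_sub_ofReal]
        have h1 : ρ / 2 ≤ |(w n).re - x| := by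
          by_contra! hcon
          apply hxρ
          rw [abs_lt] at hn hcon
          constructor <;> linarith [hn.1, hn.2, hcon.1, hcon.2]
        have h2 : (ρ / 2) ^ 2 ≤ ((w n).re - x) ^ 2 := by
          rw [← sq_abs ((w n).re - x)]
          gcongr
        nlinarith [sq_nonneg (w n).im]
    · rw [Set.indicator_of_notMem hxab]
      have : excess φ (d n) (c n) x = 0 := by
        rw [excess, hx hxab, Set.indicator_of_notMem, sub_zero]
        exact fun h => hxab ⟨(had n).trans h.1.le, h.2.trans (hcb n)⟩
      simp [this]
  · filter_upwards [hpos] with n hn x hx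
    have hN := normSq_sub_ofReal_pos (hw n) x
    refine div_le_div_of_nonneg_right ?_ hN.le
    rw [← abs_of_nonneg (hn x (hJ'.mem_Ioo hx)), abs_mul]
    exact mul_le_mul_of_nonneg_right (le_abs_excess (hφJ x (hJJ hx))) (abs_nonneg _)
  · intro x hx
    have hxt : (x - t) ^ 2 ≠ 0 := pow_ne_zero _ (sub_ne_zero.2 (hJ'.ne hx))
    refine Tendsto.div ?_ (hNt x) hxt
    exact ((((hst.const_sub x).const_mul α).add_const β).abs).const_mul δ
  · intro x hx
    have hxt : 0 < |x - t| := abs_pos.2 (sub_ne_zero.2 (hJ'.ne hx))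
    have := hl x (hJ'.mem_Ioo hx)
    rw [mul_div_assoc]
    refine mul_le_mul_of_nonneg_left ?_ hδ.le
    rw [← sq_abs (x - t), le_div_iff₀ (by positivity)]
    calc |x - t|⁻¹ * |x - t| ^ 2 = |x - t| := by field_simp
      _ ≤ _ := this

/-- If roots converge to `t` then the corresponding intervals shrink to `t`. -/
theorem tendsto_endpoints_eq (h01 : ∀ x, φ x ∈ Set.Icc (0 : ℝ) 1)
    (hφ : Integrable φ) (hout : ∀ᵐ x, x ∉ Set.Icc a b → φ x = 0)
    {J : Set ℝ} {t ε δ : ℝ} (hJ : IsSide J t ε) (hε : 0 < ε) (hδ : 0 < δ)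
    (hφJ : ∀ x ∈ J, φ x ∈ Set.Icc δ (1 - δ))
    {w : ℕ → ℂ} (hw : ∀ n, 0 < (w n).im) (hwt : Tendsto w atTop (𝓝 (t : ℂ)))
    {d c : ℕ → ℝ} {d₀ c₀ : ℝ} (had : ∀ n, a ≤ d n) (hdc : ∀ n, d n ≤ c n) (hcb : ∀ n, c n ≤ b)
    (horth : ∀ n, ∫ x, (excess φ (d n) (c n) x : ℂ) * (1 / (w n - (x : ℂ))) = 0)
    (hd : Tendsto d atTop (𝓝 d₀)) (hc : Tendsto c atTop (𝓝 c₀)) : d₀ = t ∧ c₀ = t := by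
  have hab : a ≤ b := (had 0).trans ((hdc 0).trans (hcb 0))
  have hdc₀ : d₀ ≤ c₀ := le_of_tendsto_of_tendsto' hd hc hdc
  have hdm : ∀ n, d n ∈ Set.Icc a b := fun n => ⟨had n, (hdc n).trans (hcb n)⟩
  have hcm : ∀ n, c n ∈ Set.Icc a b := fun n => ⟨(had n).trans (hdc n), hcb n⟩
  have shrink : ∀ r : ℝ, 0 < r → ∃ ρ, 0 < ρ ∧ ρ ≤ ε ∧ ρ ≤ 1 ∧ ρ ≤ r := fun r hr =>
    ⟨min (min ε 1) r, lt_min (lt_min hε one_pos) hr, (min_le_left _ _).trans (min_le_left _ _),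
      (min_le_left _ _).trans (min_le_right _ _), min_le_right _ _⟩
  have abs_le_one : ∀ ρ ≤ (1 : ℝ), ∀ x ∈ Set.Ioo (t - ρ) (t + ρ), |x - t| ≤ 1 := by
    intro ρ hρ x hx
    rw [abs_le]
    constructor <;> linarith [hx.1, hx.2]
  by_contra hne
  -- Near `t` the tests are `1` when `t` is outside `[d₀, c₀]`, `-1` inside, `d n - x` when `t = d₀
  -- < c₀`, and `x - c n` when `d₀ < t = c₀`.
  rcases lt_trichotomy t d₀ with h1 | h1 | h1
  · obtain ⟨ρ, h0, hρε, hρ1, hρ⟩ := shrink ((d₀ - t) / 2) (by linarith)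
    refine false_of_excess_mul_nonneg (α := 0) (β := 1) hab h01 hφ hout hJ h0 hρε hδ hφJ hw hwt
      had hcb horth hdm hd (fun x hx => by simpa using abs_le_one ρ hρ1 x hx) ?_
    filter_upwards [hd.eventually_const_lt (show (d₀ + t) / 2 < d₀ by linarith)] with n hn x hx
    rw [excess_of_le (by linarith [hx.2])]
    linarith [(h01 x).1]
  · rcases hdc₀.lt_or_eq with h2 | h2
    · obtain ⟨ρ, h0, hρε, -, hρ⟩ := shrink ((c₀ - t) / 2) (by linarith)
      refine false_of_excess_mul_nonneg (α := -1) (β := 0) hab h01 hφ hout hJ h0 hρε hδ hφJ hw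
        hwt had hcb horth hdm hd (fun x _ => by simp [h1, abs_sub_comm]) ?_
      filter_upwards [hc.eventually_const_lt (show (c₀ + t) / 2 < c₀ by linarith)] with n hn x hx
      have := h01 x
      rcases le_or_gt x (d n) with h3 | h3
      · rw [excess_of_le h3]
        nlinarith [this.1]
      · rw [excess_of_mem h3 (by linarith [hx.2])]
        nlinarith [this.2]
    · exact hne ⟨h1.symm, by linarith⟩
  rcases lt_trichotomy t c₀ with h2 | h2 | h2
  · obtain ⟨ρ, h0, hρε, hρ1, hρ⟩ := shrink (min ((c₀ - t) / 2) ((t - d₀) / 2))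
      (lt_min (by linarith) (by linarith))
    have hρ2 := le_min_iff.1 hρ
    refine false_of_excess_mul_nonneg (α := 0) (β := -1) hab h01 hφ hout hJ h0 hρε hδ hφJ hw hwt
      had hcb horth hdm hd (fun x hx => by simpa using abs_le_one ρ hρ1 x hx) ?_
    filter_upwards [hc.eventually_const_lt (show (c₀ + t) / 2 < c₀ by linarith),
      hd.eventually_lt_const (show d₀ < (d₀ + t) / 2 by linarith)] with n hn hn2 x hx
    rw [excess_of_mem (by linarith [hx.1, hρ2.2]) (by linarith [hx.2, hρ2.1])]
    linarith [(h01 x).2]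
  · obtain ⟨ρ, h0, hρε, -, hρ⟩ := shrink ((t - d₀) / 2) (by linarith)
    refine false_of_excess_mul_nonneg (α := 1) (β := 0) hab h01 hφ hout hJ h0 hρε hδ hφJ hw
      hwt had hcb horth hcm hc (fun x _ => by simp [h2]) ?_
    filter_upwards [hd.eventually_lt_const (show d₀ < (d₀ + t) / 2 by linarith)] with n hn x hx
    have := h01 x
    rcases le_or_gt x (c n) with h3 | h3
    · rw [excess_of_mem (by linarith [hx.1]) h3]
      nlinarith [this.2]
    · rw [excess_of_gt h3]
      nlinarith [this.1]
  · obtain ⟨ρ, h0, hρε, hρ1, hρ⟩ := shrink ((t - c₀) / 2) (by linarith)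
    refine false_of_excess_mul_nonneg (α := 0) (β := 1) hab h01 hφ hout hJ h0 hρε hδ hφJ hw hwt
      had hcb horth hdm hd (fun x hx => by simpa using abs_le_one ρ hρ1 x hx) ?_
    filter_upwards [hc.eventually_lt_const (show c₀ < (c₀ + t) / 2 by linarith)] with n hn x hx
    rw [excess_of_gt (by linarith [hx.1])]
    linarith [(h01 x).1]

end

/-! ### Compactness and passage from `μ` to its density -/

lemma isCompact_shape (a b : ℝ) : IsCompact (shape a b) := by
  refine (isCompact_Icc.prod isCompact_Icc :
    IsCompact (Set.Icc a b ×ˢ Set.Icc (0 : ℝ) 1)).of_isClosed_subset ?_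
    fun p hp => ⟨hp.1, hp.2.1⟩
  have h1 : Continuous fun p : ℝ × ℝ => p.1 + p.2 - 1 := by fun_prop
  exact (isClosed_Icc.preimage continuous_fst).inter <|
    (isClosed_Icc.preimage continuous_snd).inter <|
    (isClosed_le continuous_fst continuous_const).inter <|
    (isClosed_le h1 continuous_fst).inter (isClosed_le continuous_const h1)

lemma StrictlyBetween.exists_mem_Icc {φ : ℝ → ℝ} (h01 : ∀ x, φ x ∈ Set.Icc (0 : ℝ) 1) {s : Set ℝ}
    (h : StrictlyBetween φ s) : ∃ δ, 0 < δ ∧ ∀ x ∈ s, φ x ∈ Set.Icc δ (1 - δ) := by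
  refine ⟨min (sInf (φ '' s)) (1 - sSup (φ '' s)), lt_min h.2 (by linarith [h.1]), fun x hx => ?_⟩
  have h1 : sInf (φ '' s) ≤ φ x :=
    csInf_le ⟨0, by rintro _ ⟨y, -, rfl⟩; exact (h01 y).1⟩ ⟨x, hx, rfl⟩
  have h2 : φ x ≤ sSup (φ '' s) :=
    le_csSup ⟨1, by rintro _ ⟨y, -, rfl⟩; exact (h01 y).2⟩ ⟨x, hx, rfl⟩
  exact ⟨(min_le_left _ _).trans h1,
    by linarith [min_le_right (sInf (φ '' s)) (1 - sSup (φ '' s))]⟩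

/-- All five cases provide one side of `t` where `φ` avoids `0` and `1` uniformly; the blow-up needs
no more. -/
lemma LocalCase.exists_side {φ : ℝ → ℝ} (h01 : ∀ x, φ x ∈ Set.Icc (0 : ℝ) 1) {t ε : ℝ}
    (hε : 0 < ε) (h : LocalCase φ t ε) :
    ∃ J δ, IsSide J t ε ∧ 0 < δ ∧ ∀ x ∈ J, φ x ∈ Set.Icc δ (1 - δ) := by
  rcases h with h | ⟨h, -⟩ | ⟨h, -⟩ | ⟨h, -⟩ | ⟨h, -⟩ <;>
    obtain ⟨δ, hδ, hs⟩ := h.exists_mem_Icc h01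
  · exact ⟨_, δ, Or.inl rfl, hδ,
      fun x hx => hs x (Set.Ioo_subset_Ioo le_rfl (by linarith) hx)⟩
  · exact ⟨_, δ, Or.inl rfl, hδ, hs⟩
  · exact ⟨_, δ, Or.inl rfl, hδ, hs⟩
  · exact ⟨_, δ, Or.inr rfl, hδ, hs⟩
  · exact ⟨_, δ, Or.inr rfl, hδ, hs⟩

section

variable {φ : ℝ → ℝ}

lemma integrable_of_isProbabilityMeasure (hm : Measurable φ) (h0 : ∀ x, 0 ≤ φ x)
    [IsProbabilityMeasure ((volume : Measure ℝ).withDensity fun y => ENNReal.ofReal (φ y))] :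
    Integrable φ ∧ ∫ x, φ x = 1 := by
  have h1 : ∫⁻ x, ENNReal.ofReal (φ x) = 1 := by
    have := measure_univ (μ := (volume : Measure ℝ).withDensity fun y => ENNReal.ofReal (φ y))
    rwa [withDensity_apply _ MeasurableSet.univ, Measure.restrict_univ] at this
  have hi : Integrable φ := by
    refine ⟨hm.aestronglyMeasurable, ?_⟩
    rw [hasFiniteIntegral_iff_ofReal (Eventually.of_forall h0), h1]
    exact ENNReal.one_lt_top
  refine ⟨hi, ?_⟩
  rw [integral_eq_lintegral_of_nonneg_ae (Eventually.of_forall h0) hi.aestronglyMeasurable, h1]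
  simp

lemma ae_eq_zero_of_support_subset (hm : Measurable φ) (h0 : ∀ x, 0 ≤ φ x) {s : Set ℝ}
    (hs : ((volume : Measure ℝ).withDensity fun y => ENNReal.ofReal (φ y)).support ⊆ s) :
    ∀ᵐ x, x ∉ s → φ x = 0 := by
  have h1 : ∀ᵐ x ∂((volume : Measure ℝ).withDensity fun y => ENNReal.ofReal (φ y)), x ∈ s := by
    rw [ae_iff]
    exact measure_mono_null (Set.compl_subset_compl.2 hs) Measure.measure_compl_support
  rw [ae_withDensity_iff (by fun_prop)] at h1
  filter_upwards [h1] with x hx hxs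
  by_contra hne
  refine hxs (hx ?_)
  simpa using lt_of_le_of_ne (h0 x) (Ne.symm hne)

theorem tendsto_liquidInverse {a b : ℝ} (hab : a ≤ b) (hm : Measurable φ)
    (h01 : ∀ x, φ x ∈ Set.Icc (0 : ℝ) 1) (hφ : Integrable φ) (h1 : ∫ x, φ x = 1)
    (hout : ∀ᵐ x, x ∉ Set.Icc a b → φ x = 0) {t ε : ℝ} (hε : 0 < ε) (hcase : LocalCase φ t ε)
    {w : ℕ → UpperHalfPlane} (hwt : Tendsto (fun n => (w n : ℂ)) atTop (𝓝 (t : ℂ))) :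
    Tendsto (fun n => liquidInverse
        ((volume : Measure ℝ).withDensity fun y => ENNReal.ofReal (φ y)) a b (w n))
      atTop (𝓝 ((t, 1) : ℝ × ℝ)) := by
  obtain ⟨J, δ, hJ, hδ, hφJ⟩ := hcase.exists_side h01 hε
  -- Existence alone justifies the `epsilon` choice; the argument works for any chosen point.
  have spec := fun n => Classical.epsilon_spec
    (exists_mem_liquidRegion hab hm h01 hφ h1 hout (w n).im_pos)
  refine (isCompact_shape a b).tendsto_nhds_of_unique_mapClusterPt
    (Eventually.of_forall fun n => (spec n).1.1) fun p _ hp => ?_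
  obtain ⟨k, hk, hlim⟩ := hp.tendsto_subseq
  set P : ℕ → ℝ × ℝ := fun n => liquidInverse
    ((volume : Measure ℝ).withDensity fun y => ENNReal.ofReal (φ y)) a b (w (k n)) with hP
  have hPlim : Tendsto P atTop (𝓝 p) := hlim
  have hshape : ∀ n, P n ∈ shape a b := fun n => (spec (k n)).1.1
  have hc : Tendsto (fun n => (P n).1) atTop (𝓝 p.1) := (continuous_fst.tendsto p).comp hPlim
  have he : Tendsto (fun n => (P n).2) atTop (𝓝 p.2) := (continuous_snd.tendsto p).comp hPlim
  obtain ⟨hd₀, hc₀⟩ := tendsto_endpoints_eq h01 hφ hout hJ hε hδ hφJ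
    (fun n => (w (k n)).im_pos) (hwt.comp hk.tendsto_atTop)
    (fun n => (hshape n).2.2.2.2) (fun n => (hshape n).2.2.2.1) (fun n => (hshape n).1.2)
    (fun n => by
      rw [← fPrime_withDensity hm (fun x => (h01 x).1) hφ (hshape n).2.1.2 (w (k n)).im_pos]
      exact (spec (k n)).2)
    ((hc.add he).sub_const 1) hc
  exact Prod.ext hc₀ (by simp only; linarith)

end

end GTLiquid

/-! ### Boundary point and conclusion -/

theorem mainTheorem8
    (a b : ℝ) (hab : 1 < b - a)
    (μ : Measure ℝ) [IsProbabilityMeasure μ]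
    (hsupp : μ.support ⊆ Set.Icc a b) (ha : a ∈ μ.support) (hb : b ∈ μ.support)
    (x : (n : ℕ) → Fin n → ℤ) (hx : ∀ n : ℕ, StrictAnti (x n))
    (hconv : Tendsto (fun n : ℕ => GTLiquid.empiricalMeasure n (x n)) atTop
      (𝓝 (⟨μ, inferInstance⟩ : FiniteMeasure ℝ)))
    (φ : ℝ → ℝ) (hφ_meas : Measurable φ) (hφ_mem : ∀ y : ℝ, φ y ∈ Set.Icc (0 : ℝ) 1)
    (hφ : μ = (volume : Measure ℝ).withDensity fun y => ENNReal.ofReal (φ y))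
    (t : ℝ) (ht : t ∉ GTLiquid.edgeParameters μ)
    (hcase : ∃ ε : ℝ, 0 < ε ∧ GTLiquid.LocalCase φ t ε) :
    ((t, 1) : ℝ × ℝ) ∈ frontier (GTLiquid.liquidRegion μ a b) ∧
      ∀ w : ℕ → UpperHalfPlane,
        Tendsto (fun n => ((w n : UpperHalfPlane) : ℂ)) atTop (𝓝 (t : ℂ)) →
        Tendsto (fun n => GTLiquid.liquidInverse μ a b (w n)) atTop (𝓝 ((t, 1) : ℝ × ℝ)) := by
  subst hφ
  obtain ⟨ε, hε, hcase⟩ := hcase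
  have h0 : ∀ y, 0 ≤ φ y := fun y => (hφ_mem y).1
  have hle : a ≤ b := by linarith
  obtain ⟨hφi, hφ1⟩ := GTLiquid.integrable_of_isProbabilityMeasure hφ_meas h0
  have hout := GTLiquid.ae_eq_zero_of_support_subset hφ_meas h0 hsupp
  have hlim := fun (w : ℕ → UpperHalfPlane) hwt => GTLiquid.tendsto_liquidInverse hle hφ_meas
    hφ_mem hφi hφ1 hout hε hcase (w := w) hwt
  refine ⟨⟨?_, fun hint => ?_⟩, hlim⟩
  · let w : ℕ → UpperHalfPlane := fun n =>
      ⟨(t : ℂ) + ((1 / ((n : ℝ) + 1) : ℝ) : ℂ) * Complex.I, by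
        have h1 : 0 < 1 / ((n : ℝ) + 1) := by positivity
        rw [Complex.add_im, Complex.ofReal_im, zero_add, Complex.im_ofReal_mul, Complex.I_im,
          mul_one]
        exact h1⟩
    have hw : Tendsto (fun n => (w n : ℂ)) atTop (𝓝 (t : ℂ)) := by
      have h1 : Tendsto (fun n : ℕ => ((1 / ((n : ℝ) + 1) : ℝ) : ℂ)) atTop (𝓝 ((0 : ℝ) : ℂ)) :=
        (Complex.continuous_ofReal.tendsto 0).comp tendsto_one_div_add_atTop_nhds_zero_nat
      have h2 := (h1.mul_const Complex.I).const_add (t : ℂ)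
      rw [Complex.ofReal_zero, zero_mul, add_zero] at h2
      exact h2
    exact mem_closure_of_tendsto (hlim w hw) (Eventually.of_forall fun n =>
      (Classical.epsilon_spec (GTLiquid.exists_mem_liquidRegion hle hφ_meas hφ_mem hφi hφ1 hout
        (w n).im_pos)).1)
  -- Points with `η > 1` lie outside the shape, so `(t, 1)` is not interior.
  · have hseq : Tendsto (fun n : ℕ => ((t, 1 + 1 / ((n : ℝ) + 1)) : ℝ × ℝ)) atTop
        (𝓝 ((t, 1) : ℝ × ℝ)) := by
      refine tendsto_const_nhds.prodMk_nhds ?_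
      simpa using tendsto_one_div_add_atTop_nhds_zero_nat.const_add (1 : ℝ)
    obtain ⟨n, hn⟩ := (hseq.eventually (mem_interior_iff_mem_nhds.1 hint)).exists
    have h1 : 1 + 1 / ((n : ℝ) + 1) ≤ 1 := hn.1.2.1.2
    have h2 : 0 < 1 / ((n : ℝ) + 1) := by positivity
    linarith
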